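/- A flow of a monoid $M$ on an object $X$ of a category $\mathcal C$ is a monoid morphism $M\to \mathcal C(X,X)$; for concrete $\mathcal C$ it is identified with the resulting action map $M\times X\to X$, $(s,x)\mapsto s\triangleright x$ (so each $s\in M$ acts by a morphism of $\mathcal C$, with no other continuity assumed). For a constraint $\mathcal F$ on flows, ${}_{\mathcal F}\mathcal C^{M}$ is the category whose objects are the flows in $\mathcal C$ meeting $\mathcal F$ and whose morphisms are the $M$-equivariant morphisms of $\mathcal C$. For a topological space $Y$, $\kappa(Y)$ is the set $Y$ in which a set is open iff its intersection with every compact subspace $K$ of $Y$ is open in $K$; $Y$ is compactly generated if $\kappa(Y)=Y$; and $Y\times^{\kappa}Z:=\kappa(Y\times Z)$. **Theorem.** Let $M$ be a monoid and let $\mathcal S,\mathcal J\subseteq 2^{M}$ be families of subsets of $M$. The functor ${}_{\mathcal F}\mathcal C^{M}\to\mathcal C$ that forgets the action is monadic (it has a left adjoint, and the comparison functor to the Eilenberg–Moore category of the induced monad is an equivalence) in each of the following cases. (a) $M$ is a topological monoid; $\mathcal C$ is the category of all topological spaces, or of all $T_0$, $T_1$, Hausdorff, functionally Hausdorff (any two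 distinct points are separated by a continuous real-valued function), Tychonoff, or compact Hausdorff spaces, with continuous maps; and $\mathcal F$ requires the action to be separately continuous over $S\times X$ for every $S\in\mathcal S$ and jointly continuous over $J\times X$ for every $J\in\mathcal J$. (b) $M$ is equipped with a uniformity (not assumed compatible with the multiplication); $\mathcal C$ is the category of all uniform spaces, of Hausdorff uniform spaces, or of complete Hausdorff uniform spaces, with uniformly continuous maps; and $\mathcal F$ requires the action to be separately uniformly continuous over $S\times X$ for every $S\in\mathcal S$ and jointly uniformly continuous over $J\times X$ for every $J\in\mathcal J$. (c) $M$ carries a compactly generated topology for which the multiplication $M\times^{\kappa}M\to M$ is continuous; $\mathcal C$ is the category of compactly generated spaces or of compactly generated Hausdorff spaces, with continuous maps; and $\mathcal F$ requires the action to be separately continuous over $\kappa(S)\times X$ for every $S\in\mathcal S$ and jointly continuous over $\kappa(J)\times^{\kappa}X$ for every $J\in\mathcal J$. (d) $M$ is a topological group; $\mathcal C$ is one of the three categories of uniform spaces in (b); and $\mathcal F$ is one of the following two requirements: - boundedness: for every entourage $V$ of $X$ there is a neighbourhood $N$ of $1$ in $M$ with $(s\triangleright x,x)\in V$ for all $s\in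 N$ and $x\in X$; - quasi-boundedness: for every entourage $W$ of $X$ there are a neighbourhood $N$ of $1$ in $M$ and an entourage $V$ of $X$ with $(s\triangleright x,s\triangleright y)\in W$ for all $s\in N$ and $(x,y)\in V$. -/

import Mathlib

open CategoryTheory Topology Uniformity
open scoped CompactCoherentification

universe u

namespace Flows

/-- A functor is monadic if it has a left adjoint and the comparison functor into the
Eilenberg-Moore category of the induced monad is an equivalence. -/
def IsMonadic {D : Type (u + 1)} [Category.{u} D] {C : Type (u + 1)} [Category.{u} C]
    (G : D ⥤ C) : Prop :=
  Nonempty (MonadicRightAdjoint G)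

/-! ### Constrained flows

A flow of the monoid `M` on an object `X` of `C` is a monoid morphism `M →* End X`, that is, an
object of `Action C M`; in particular every element of `M` acts by a morphism of `C`.  The
morphisms of flows are the equivariant morphisms of `C`. -/

/-- The category of flows of `M` in `C` that satisfy the constraint `F`
(all equivariant morphisms are allowed). -/
abbrev FlowCat {C : Type (u + 1)} [Category.{u} C] {M : Type u} [Monoid M]
    (F : ObjectProperty (Action C M)) : Type (u + 1) :=
  F.FullSubcategory

/-- The functor that forgets the action and keeps the underlying object of `C`. -/
abbrev forgetFlow {C : Type (u + 1)} [Category.{u} C] {M : Type u} [Monoid M]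
    (F : ObjectProperty (Action C M)) : FlowCat F ⥤ C :=
  F.ι ⋙ Action.forget C M

/-! ### Categories of topological spaces -/

/-- Any two distinct points are separated by a continuous real-valued function. -/
def FunctionallyHausdorff (X : Type u) [TopologicalSpace X] : Prop :=
  ∀ x y : X, x ≠ y → ∃ f : X → ℝ, Continuous f ∧ f x ≠ f y

/-- Labels for the full subcategories of topological spaces under consideration: all spaces,
`T₀`, `T₁`, Hausdorff, functionally Hausdorff, Tychonoff, compact Hausdorff. -/
inductive TopKind : Type
  | all | t0 | t1 | t2 | t2f | t35 | compactT2

/-- The class of topological spaces with a given label. -/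
def TopKind.prop : TopKind → ObjectProperty TopCat.{u}
  | .all => fun _ => True
  | .t0 => fun X => T0Space X
  | .t1 => fun X => T1Space X
  | .t2 => fun X => T2Space X
  | .t2f => fun X => FunctionallyHausdorff X
  | .t35 => fun X => T35Space X
  | .compactT2 => fun X => CompactSpace X ∧ T2Space X

/-- Labels for the full subcategories of compactly generated spaces: all, or Hausdorff. -/
inductive KTopKind : Type
  | all | t2

/-- The class of compactly generated spaces with a given label.  `CompactlyCoherentSpace X` says
that a set is open as soon as its trace on every compact subspace `K` is open in `K`. -/
def KTopKind.prop : KTopKind → ObjectProperty TopCat.{u}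
  | .all => fun X => CompactlyCoherentSpace X
  | .t2 => fun X => CompactlyCoherentSpace X ∧ T2Space X

/-- The uncurried action map `M × X → X` of a flow on a space `X`. -/
def topAct {P : ObjectProperty TopCat.{u}} {M : Type u} [Monoid M]
    (A : Action P.FullSubcategory M) (m : M) (x : A.V.obj) : A.V.obj :=
  (A.ρ m : A.V ⟶ A.V).hom x

/-- The action is separately continuous over `S × X` for `S ∈ 𝒮`
and jointly continuous over `J × X` for `J ∈ 𝒥`. -/
def TopConstraint (P : ObjectProperty TopCat.{u}) (M : Type u) [Monoid M] [TopologicalSpace M]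
    (𝒮 𝒥 : Set (Set M)) : ObjectProperty (Action P.FullSubcategory M) := fun A =>
  (∀ S ∈ 𝒮, (∀ s : S, Continuous fun x : A.V.obj => topAct A s x) ∧
    ∀ x : A.V.obj, Continuous fun s : S => topAct A s x) ∧
  ∀ J ∈ 𝒥, Continuous fun p : J × A.V.obj => topAct A p.1 p.2

/-- The multiplication of `M` is continuous on the compactly generated product `M ×ᵏ M`, the
coreflection `𝐤 (M × M)` of the usual product.  Together with compact generation of `M` this says
that `M` is an internal monoid in compactly generated spaces. -/
def KContinuousMul (M : Type u) [Monoid M] [TopologicalSpace M] : Prop :=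
  Continuous fun p : 𝐤 (M × M) =>
    ((CompactCoherentification.mk (M × M)).symm p).1 *
      ((CompactCoherentification.mk (M × M)).symm p).2

/-- The action is separately continuous over `𝐤 S × X` for `S ∈ 𝒮` and continuous on the compactly
generated product `𝐤 J ×ᵏ X = 𝐤 (𝐤 J × X)` for `J ∈ 𝒥`. -/
def KTopConstraint (P : ObjectProperty TopCat.{u}) (M : Type u) [Monoid M] [TopologicalSpace M]
    (𝒮 𝒥 : Set (Set M)) : ObjectProperty (Action P.FullSubcategory M) := fun A =>
  (∀ S ∈ 𝒮, (∀ s : S, Continuous fun x : A.V.obj => topAct A s x) ∧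
    ∀ x : A.V.obj, Continuous fun s : 𝐤 S =>
      topAct A ((CompactCoherentification.mk S).symm s) x) ∧
  ∀ J ∈ 𝒥, Continuous fun p : 𝐤 ((𝐤 J) × A.V.obj) =>
    topAct A
      ((CompactCoherentification.mk J).symm
        ((CompactCoherentification.mk ((𝐤 J) × A.V.obj)).symm p).1)
      ((CompactCoherentification.mk ((𝐤 J) × A.V.obj)).symm p).2

/-! ### Categories of uniform spaces -/

/-- Labels for the full subcategories of uniform spaces under consideration: all, Hausdorff,
complete Hausdorff. -/
inductive UnifKind : Type
  | all | t2 | completeT2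

/-- The class of uniform spaces with a given label. -/
def UnifKind.prop : UnifKind → ObjectProperty UniformSpaceCat.{u}
  | .all => fun _ => True
  | .t2 => fun X => T2Space X
  | .completeT2 => fun X => CompleteSpace X ∧ T2Space X

/-- The uncurried action map `M × X → X` of a flow on a uniform space `X`. -/
def unifAct {P : ObjectProperty UniformSpaceCat.{u}} {M : Type u} [Monoid M]
    (A : Action P.FullSubcategory M) (m : M) (x : A.V.obj) : A.V.obj :=
  (A.ρ m : A.V ⟶ A.V).hom x

/-- The action is separately uniformly continuous over `S × X` for `S ∈ 𝒮`
and jointly uniformly continuous over `J × X` for `J ∈ 𝒥`. -/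
def UnifConstraint (P : ObjectProperty UniformSpaceCat.{u}) (M : Type u) [Monoid M]
    [UniformSpace M] (𝒮 𝒥 : Set (Set M)) : ObjectProperty (Action P.FullSubcategory M) := fun A =>
  (∀ S ∈ 𝒮, (∀ s : S, UniformContinuous fun x : A.V.obj => unifAct A s x) ∧
    ∀ x : A.V.obj, UniformContinuous fun s : S => unifAct A s x) ∧
  ∀ J ∈ 𝒥, UniformContinuous fun p : J × A.V.obj => unifAct A p.1 p.2

/-- Bounded flows: for every entourage `V` there is a neighbourhood `N` of the identity with
`(s ▷ y, y) ∈ V` for all `s ∈ N` and all points `y`. -/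
def BoundedFlow (P : ObjectProperty UniformSpaceCat.{u}) (G : Type u) [Group G]
    [TopologicalSpace G] : ObjectProperty (Action P.FullSubcategory G) := fun A =>
  ∀ V ∈ 𝓤 A.V.obj, ∃ N ∈ 𝓝 (1 : G), ∀ s ∈ N, ∀ y : A.V.obj, (unifAct A s y, y) ∈ V

/-- Quasi-bounded flows: for every entourage `W` there are a neighbourhood `N` of the identity and
an entourage `V` with `(s ▷ x, s ▷ y) ∈ W` for all `s ∈ N` and all `(x, y) ∈ V`. -/
def QuasiBoundedFlow (P : ObjectProperty UniformSpaceCat.{u}) (G : Type u) [Group G]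
    [TopologicalSpace G] : ObjectProperty (Action P.FullSubcategory G) := fun A =>
  ∀ W ∈ 𝓤 A.V.obj, ∃ N ∈ 𝓝 (1 : G), ∃ V ∈ 𝓤 A.V.obj, ∀ s ∈ N, ∀ x y : A.V.obj,
    (x, y) ∈ V → (unifAct A s x, unifAct A s y) ∈ W

end Flows

/-!
Monadicity is proved with Beck's theorem, whose two hypotheses are checked separately.

*Split coequalizers.* Let `q : B ⟶ Z` be a coequalizer in `C` of two equivariant morphisms into `B`,
split by `s : Z ⟶ B`. Then `m ▷ z = q (m ▷ s z)` is the only action for which `q` is equivariant,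
and it makes `Z` the coequalizer in the category of flows. By the same formula the action map
of `Z` is composed of that of `B` and of morphisms of `C`, so that `Z` meets every constraint
in question (`ClosedUnderSplitQuotients`, `isMonadic_of_isRightAdjoint`).

*Left adjoint.* A product of flows is a flow for the componentwise action. A morphism from `X` into
a flow `A` factors through the subflow generated by `X`, which is the union of the orbits of the
image, or the closure of that union when `C` consists of compact Hausdorff or of complete Hausdorff
spaces. Equivariant morphisms out of this subflow are determined by their restriction to `X`, and
its cardinality is bounded in terms of `M` and `X`; hence there is only a set of such flows up to
isomorphism. The free flow on `X` is generated by `X` in the product of all of them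
(`isRightAdjoint_of_generating`, `exists_generated_flow`).

Products and generated subflows carry structures that are initial with respect to equivariant
morphisms into flows meeting the constraint. So all that is needed of a constraint is that it passes
to split quotients and to initial sources (`isMonadic_forgetFlow`). For compactly generated spaces,
the initial structure is the compactly generated refinement of the initial topology.
-/

/-! ### Beck's theorem and the adjoint functor theorem -/

namespace Flows

open Limits

section Beck

variable {C : Type (u + 1)} [Category.{u} C] {M : Type u} [Monoid M]

/-- A constraint `F` passes to split quotients if it is inherited along equivariant morphisms
`q : A ⟶ B` that have a section in `C`; the section need not be equivariant. -/
def ClosedUnderSplitQuotients (F : ObjectProperty (Action C M)) : Prop :=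
  ∀ ⦃A B : Action C M⦄ (q : A ⟶ B) (s : B.V ⟶ A.V), s ≫ q.hom = 𝟙 B.V → F A → F B

theorem comp_splitCoequalizer_ρ {A B : Action C M} (f g : A ⟶ B) {Z : C} {q : B.V ⟶ Z}
    (t : IsSplitCoequalizer f.hom g.hom q) (m : M) :
    q ≫ t.rightSection ≫ B.ρ m ≫ q = (B.ρ m : B.V ⟶ B.V) ≫ q := by
  have h₁ := t.leftSection_top_assoc ((B.ρ m : B.V ⟶ B.V) ≫ q)
  have h₂ := t.leftSection_bottom_assoc ((B.ρ m : B.V ⟶ B.V) ≫ q)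
  rw [← h₁, ← f.comm_assoc, t.condition, g.comm_assoc, h₂]

/-- The flow on a coequalizer that is split in `C`: the element `m` acts by applying the section,
then `m`, then the quotient morphism. -/
def splitQuotient {A B : Action C M} (f g : A ⟶ B) {Z : C} {q : B.V ⟶ Z}
    (t : IsSplitCoequalizer f.hom g.hom q) : Action C M where
  V := Z
  ρ :=
    { toFun := fun m => (t.rightSection ≫ B.ρ m ≫ q : Z ⟶ Z)
      map_one' := by simp [End.one_def]
      map_mul' := fun m n => by
        simp only [End.mul_def, map_mul, Category.assoc]
        rw [comp_splitCoequalizer_ρ f g t] }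

/-- The quotient morphism onto a split coequalizer, as an equivariant morphism. -/
def splitQuotientπ {A B : Action C M} (f g : A ⟶ B) {Z : C} {q : B.V ⟶ Z}
    (t : IsSplitCoequalizer f.hom g.hom q) : B ⟶ splitQuotient f g t where
  hom := q
  comm := fun m => (comp_splitCoequalizer_ρ f g t m).symm

/-- If the constraint passes to split quotients, a pair of morphisms of flows that is split in `C`
has a coequalizer of flows, and this coequalizer is the one in `C`. -/
theorem exists_isColimit_of_isSplitPair {F : ObjectProperty (Action C M)}
    (hF : ClosedUnderSplitQuotients F) {A B : FlowCat F} (f g : A ⟶ B)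
    [(forgetFlow F).IsSplitPair f g] :
    ∃ c : Cocone (parallelPair f g), Nonempty (IsColimit c) ∧
      Nonempty (IsColimit ((forgetFlow F).mapCocone c)) := by
  obtain ⟨Z, q, ⟨t⟩⟩ : ∃ (Z : C) (q : B.obj.V ⟶ Z),
      Nonempty (IsSplitCoequalizer f.hom.hom g.hom.hom q) := HasSplitCoequalizer.splittable
    (f := (forgetFlow F).map f) (g := (forgetFlow F).map g)
  let Q : FlowCat F := ⟨splitQuotient f.hom g.hom t,
    hF (splitQuotientπ f.hom g.hom t) t.rightSection t.rightSection_π B.property⟩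
  let π : B ⟶ Q := ObjectProperty.homMk (splitQuotientπ f.hom g.hom t)
  have w : f ≫ π = g ≫ π := by
    ext
    exact t.condition
  refine ⟨Cofork.ofπ π w, ⟨Cofork.IsColimit.mk' _ fun s => ?_⟩,
    ⟨(isColimitMapCoconeCoforkEquiv (forgetFlow F) w).symm t.isCoequalizer⟩⟩
  have hs : (f.hom.hom : A.obj.V ⟶ B.obj.V) ≫ s.π.hom.hom = g.hom.hom ≫ s.π.hom.hom :=
    congrArg (fun k => k.hom.hom) s.condition
  have hq : q ≫ t.rightSection ≫ s.π.hom.hom = s.π.hom.hom := by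
    have h₁ := t.leftSection_top_assoc s.π.hom.hom
    have h₂ := t.leftSection_bottom_assoc s.π.hom.hom
    rw [← h₁]
    refine Eq.trans ?_ h₂
    exact congrArg (t.leftSection ≫ ·) hs
  refine ⟨ObjectProperty.homMk ⟨t.rightSection ≫ s.π.hom.hom, fun m => ?_⟩, ?_, fun {k} hk => ?_⟩
  · change (t.rightSection ≫ (B.obj.ρ m : B.obj.V ⟶ B.obj.V) ≫ q) ≫
      t.rightSection ≫ s.π.hom.hom = _
    simp only [Category.assoc]
    rw [hq, s.π.hom.comm]
    exact (Category.assoc _ _ _).symm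
  · ext
    exact hq
  · ext
    change k.hom.hom = t.rightSection ≫ s.π.hom.hom
    rw [← hk]
    exact (t.rightSection_π_assoc k.hom.hom).symm

/-- Beck's theorem for flows: coequalizers of split pairs are unproblematic as soon as the
constraint passes to split quotients, so that only the left adjoint is in question. -/
theorem isMonadic_of_isRightAdjoint {F : ObjectProperty (Action C M)}
    (hF : ClosedUnderSplitQuotients F) [(forgetFlow F).IsRightAdjoint] :
    IsMonadic (forgetFlow F) := by
  have : (Action.forget C M).ReflectsIsomorphisms := ⟨fun f h => by
    have : IsIso f.hom := h
    exact Action.isIso_of_hom_isIso f⟩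
  have : (forgetFlow F).ReflectsIsomorphisms := reflectsIsomorphisms_comp _ _
  have : Monad.HasCoequalizerOfIsSplitPair (forgetFlow F) := ⟨fun f g _ => by
    obtain ⟨c, ⟨hc⟩, -⟩ := exists_isColimit_of_isSplitPair hF f g
    exact ⟨c, hc⟩⟩
  have : Monad.PreservesColimitOfIsSplitPair (forgetFlow F) := ⟨fun f g _ => by
    obtain ⟨c, ⟨hc⟩, ⟨hc'⟩⟩ := exists_isColimit_of_isSplitPair hF f g
    exact preservesColimit_of_preserves_colimit_cocone hc hc'⟩
  exact ⟨Monad.monadicOfHasPreservesGSplitCoequalizersOfReflectsIsomorphisms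
    (Adjunction.ofIsRightAdjoint (forgetFlow F))⟩

end Beck

/-- A form of the general adjoint functor theorem: `U` has a left adjoint if families of objects
have weak products that are compatible with `U`, and if every morphism from `X` to some `U A` factors
through a generating morphism from `X` to one of a set of objects. -/
theorem isRightAdjoint_of_generating {C : Type (u + 1)} [Category.{u} C]
    {D : Type (u + 1)} [Category.{u} D] (U : D ⥤ C)
    (hprod : ∀ {ι : Type u} (A : ι → D), ∃ (Z : D) (π : ∀ i, Z ⟶ A i),
      ∀ (X : C) (f : ∀ i, X ⟶ U.obj (A i)), ∃ g : X ⟶ U.obj Z, ∀ i, g ≫ U.map (π i) = f i)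
    (hgen : ∀ X : C, ∃ (ι : Type u) (B : ι → D), ∀ (A : D) (f : X ⟶ U.obj A),
      ∃ (i : ι) (g : X ⟶ U.obj (B i)) (m : B i ⟶ A), g ≫ U.map m = f ∧
        ∀ (A' : D) (h k : B i ⟶ A'), g ≫ U.map h = g ≫ U.map k → h = k) :
    U.IsRightAdjoint := by
  rw [isRightAdjoint_iff_hasInitial_structuredArrow]
  intro X
  obtain ⟨ι, B, hB⟩ := hgen X
  obtain ⟨Z, π, hZ⟩ := hprod (fun p : Σ i, X ⟶ U.obj (B i) => B p.1)
  obtain ⟨g, hg⟩ := hZ X (fun p => p.2)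
  -- The initial arrow is generated by `X` in the product of all generating arrows.
  obtain ⟨i₀, g₀, m₀, h₀, hu⟩ := hB Z g
  have (Y : StructuredArrow X U) : Nonempty (StructuredArrow.mk g₀ ⟶ Y) := by
    obtain ⟨i, g', m, h, -⟩ := hB Y.right Y.hom
    refine ⟨StructuredArrow.homMk (m₀ ≫ π ⟨i, g'⟩ ≫ m) ?_⟩
    have := hg ⟨i, g'⟩
    simp only [StructuredArrow.mk_hom_eq_self, Functor.map_comp]
    rw [reassoc_of% h₀, reassoc_of% this, h]
  have (Y : StructuredArrow X U) : Subsingleton (StructuredArrow.mk g₀ ⟶ Y) := by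
    refine ⟨fun a b => StructuredArrow.ext _ _ (hu _ _ _ ?_)⟩
    exact (StructuredArrow.w a).trans (StructuredArrow.w b).symm
  exact hasInitial_of_unique (StructuredArrow.mk g₀)

/-! ### Flows in concrete categories with initial sources -/

open Set

section Concrete

variable (C : Type (u + 1)) [Category.{u} C] {FC : C → C → Type u} {CC : C → Type u}
  [∀ X Y, FunLike (FC X Y) (CC X) (CC Y)] [ConcreteCategory.{u} C FC]

/-- A notion of initial source on a concrete category. The intended meaning of
`IsInitial φ` is that the object `Z` carries the structure induced by the morphisms `φ i`. Such
sources have to satisfy the usual lifting property, products formed on the cartesian product of the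
underlying sets have to exist, and there may be only a set of structures on each set. -/
structure InitialSources where
  /-- The distinguished sources. -/
  IsInitial : ∀ {ι : Type u} {Z : C} {A : ι → C}, (∀ i, Z ⟶ A i) → Prop
  lift : ∀ {ι : Type u} {Z : C} {A : ι → C} {φ : ∀ i, Z ⟶ A i}, IsInitial φ →
    ∀ {Y : C} (h : CC Y → CC Z), (∀ i, ∃ k : Y ⟶ A i, ∀ y, k y = φ i (h y)) →
      ∃ k : Y ⟶ Z, ∀ y, k y = h y
  prod : ∀ {ι : Type u} (A : ι → C), ∃ (Z : C) (φ : ∀ i, Z ⟶ A i),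
    IsInitial φ ∧ Function.Bijective fun (z : CC Z) i => (φ i z : CC (A i))
  small : ∀ K : Type u, ∃ (ι : Type u) (B : ι → C), ∀ A : C,
    (∃ j : CC A → K, Function.Injective j) → ∃ i, Nonempty (A ≅ B i)

variable {C}

/-- A system of hulls of subsets, each of them the underlying set of a subobject with the induced
structure, functorial in the object. A morphism out of a hull is determined by its values on
the given subset, and the size of the hull is bounded in terms of the size of that subset; filters
are large enough to cover closures in Hausdorff spaces. -/
structure HullSystem (T : InitialSources C) where
  /-- The hull of a subset of the underlying set of an object. -/
  hull : ∀ {A : C}, Set (CC A) → Set (CC A)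
  subset_hull : ∀ {A : C} (D : Set (CC A)), D ⊆ hull D
  mapsTo_hull : ∀ {A B : C} (f : A ⟶ B) {D : Set (CC A)} {E : Set (CC B)},
    MapsTo f D E → MapsTo f (hull D) (hull E)
  exists_injective : ∀ {A : C} (D : Set (CC A)), ∃ j : hull D → Filter D, Function.Injective j
  sub : ∀ {A : C} (D : Set (CC A)), ∃ (Z : C) (ψ : Z ⟶ A),
    T.IsInitial (fun _ : PUnit.{u + 1} => ψ) ∧ Function.Injective ψ ∧ range ψ = hull D
  hom_ext : ∀ {Z A A' : C} (ψ : Z ⟶ A) (D : Set (CC A)),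
    T.IsInitial (fun _ : PUnit.{u + 1} => ψ) → range ψ = hull D →
    ∀ h k : Z ⟶ A', (∀ z, ψ z ∈ D → h z = k z) → h = k

variable {M : Type u} [Monoid M]

/-- A constraint `F` is inherited along initial sources of equivariant morphisms. -/
def ClosedUnderInitialSources (T : InitialSources C) (F : ObjectProperty (Action C M)) : Prop :=
  ∀ ⦃ι : Type u⦄ ⦃Z : Action C M⦄ ⦃A : ι → Action C M⦄ (φ : ∀ i, Z ⟶ A i),
    T.IsInitial (fun i => (φ i).hom) → (∀ i, F (A i)) → F Z

/-- The action of an element of `M` on the underlying set of a flow. -/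
def act (A : Action C M) (m : M) (x : CC A.V) : CC A.V :=
  ConcreteCategory.hom (X := A.V) (Y := A.V) (A.ρ m) x

@[simp]
theorem act_one (A : Action C M) (x : CC A.V) : act A 1 x = x := by
  simp [act, End.one_def]

theorem act_mul (A : Action C M) (m n : M) (x : CC A.V) :
    act A (m * n) x = act A m (act A n x) := by
  simp [act, End.mul_def]

theorem hom_act {A B : Action C M} (f : A ⟶ B) (m : M) (x : CC A.V) :
    f.hom (act A m x) = act B m (f.hom x) := by
  rw [act, act, ← comp_apply, ← comp_apply, f.comm]

/-- An initial source of underlying objects of flows lifts to flows if its domain carries a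
compatible action on the level of sets. -/
theorem InitialSources.exists_action (T : InitialSources C) {ι : Type u} {Z : C}
    {A : ι → Action C M} (φ : ∀ i, Z ⟶ (A i).V) (hφ : T.IsInitial φ)
    (hinj : ∀ y z : CC Z, (∀ i, φ i y = φ i z) → y = z) (a : M → CC Z → CC Z)
    (ha : ∀ i m z, φ i (a m z) = act (A i) m (φ i z)) :
    ∃ (ρ : M →* End Z) (ψ : ∀ i, Action.mk Z ρ ⟶ A i), ∀ i, (ψ i).hom = φ i := by
  have (m : M) : ∃ k : Z ⟶ Z, ∀ z, k z = a m z :=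
    T.lift hφ (a m) fun i => ⟨φ i ≫ (A i).ρ m, fun z => by rw [ha, comp_apply]; rfl⟩
  choose r hr using this
  have hrφ (i m) (z : CC Z) : φ i (r m z) = act (A i) m (φ i z) := by
    rw [hr, ha]
  let ρ : M →* End Z :=
    { toFun := r
      map_one' := ConcreteCategory.hom_ext _ _ fun z => hinj _ _ fun i => by
        rw [hrφ, act_one, End.one_def, id_apply]
      map_mul' := fun m n => ConcreteCategory.hom_ext _ _ fun z => hinj _ _ fun i => by
        rw [hrφ, act_mul, End.mul_def, comp_apply, hrφ, hrφ] }
  exact ⟨ρ, fun i => ⟨φ i, fun m => ConcreteCategory.hom_ext _ _ fun z => by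
    rw [comp_apply, comp_apply]; exact hrφ i m z⟩, fun i => rfl⟩

/-- Families of flows have a product flow, formed on the product in `C`. -/
theorem exists_flow_prod (T : InitialSources C) {F : ObjectProperty (Action C M)}
    (hF : ClosedUnderInitialSources T F) {ι : Type u} (A : ι → FlowCat F) :
    ∃ (Z : FlowCat F) (π : ∀ i, Z ⟶ A i), ∀ (X : C) (f : ∀ i, X ⟶ (A i).obj.V),
      ∃ g : X ⟶ Z.obj.V, ∀ i, g ≫ (π i).hom.hom = f i := by
  obtain ⟨Z, φ, hφ, hinj, hsurj⟩ := T.prod fun i => (A i).obj.V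
  choose pt hpt using hsurj
  replace hpt (x : ∀ i, CC (A i).obj.V) (i) : φ i (pt x) = x i := congrFun (hpt x) i
  obtain ⟨ρ, ψ, hψ⟩ := T.exists_action (A := fun i => (A i).obj) φ hφ
    (fun y z h => hinj (funext h)) (fun m z => pt fun i => act (A i).obj m (φ i z))
    (fun i m z => hpt _ i)
  obtain rfl : φ = fun i => (ψ i).hom := funext fun i => (hψ i).symm
  refine ⟨⟨Action.mk Z ρ, hF ψ hφ fun i => (A i).property⟩, fun i => ObjectProperty.homMk (ψ i),
    fun X f => ?_⟩
  obtain ⟨g, hg⟩ := T.lift hφ (Y := X) (fun x => pt fun i => f i x)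
    fun i => ⟨f i, fun x => (hpt (fun i => f i x) i).symm⟩
  exact ⟨g, fun i => ConcreteCategory.hom_ext _ _ fun x => by
    rw [comp_apply, hg]; exact hpt _ i⟩

/-- Up to isomorphism there is only a set of flows whose underlying set embeds into `K`. -/
theorem exists_small_flows (T : InitialSources C) {F : ObjectProperty (Action C M)}
    (hF : ClosedUnderSplitQuotients F) (K : Type u) :
    ∃ (ι : Type u) (B : ι → FlowCat F), ∀ A : FlowCat F,
      (∃ j : CC A.obj.V → K, Function.Injective j) → ∃ i, Nonempty (A ≅ B i) := by
  obtain ⟨ι, B, hB⟩ := T.small K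
  refine ⟨Σ i, {ρ : M →* End (B i) // F ⟨B i, ρ⟩}, fun p => ⟨⟨B p.1, p.2.1⟩, p.2.2⟩,
    fun A hA => ?_⟩
  obtain ⟨i, ⟨e⟩⟩ := hB A.obj.V hA
  let A' : Action C M := ⟨B i, e.conj.toMonoidHom.comp A.obj.ρ⟩
  let e' : A.obj ≅ A' := Action.mkIso e fun m => by simp [A', Iso.conj_apply]
  -- An isomorphism is in particular a split quotient.
  have hA' : F A' := hF e'.hom e.inv e.inv_hom_id A.property
  exact ⟨⟨i, A'.ρ, hA'⟩, ⟨F.isoMk e'⟩⟩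

/-- A morphism from `X` into a flow factors through a flow generated by `X`, namely the hull of the
union of the orbits of the image, and the size of that flow is bounded in terms of `M` and `X`. -/
theorem exists_generated_flow {T : InitialSources C} (H : HullSystem T)
    {F : ObjectProperty (Action C M)} (hF : ClosedUnderInitialSources T F) (X : C)
    (A : FlowCat F) (f : X ⟶ A.obj.V) :
    ∃ (B : FlowCat F) (g : X ⟶ B.obj.V) (m : B ⟶ A),
      (∃ j : CC B.obj.V → Filter (M × CC X), Function.Injective j) ∧ g ≫ m.hom.hom = f ∧
      ∀ (A' : FlowCat F) (h k : B ⟶ A'), g ≫ h.hom.hom = g ≫ k.hom.hom → h = k := by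
  let orb : M × CC X → CC A.obj.V := fun p => act A.obj p.1 (f p.2)
  let D := range orb
  have hfD (x : CC X) : f x ∈ D := ⟨(1, x), act_one _ _⟩
  have hD (m : M) : MapsTo (act A.obj m) D D := by
    rintro _ ⟨⟨n, x⟩, rfl⟩
    exact ⟨(m * n, x), act_mul _ _ _ _⟩
  obtain ⟨Z, φ, hφ, hinj, hrange⟩ := H.sub D
  have hex (y : CC A.obj.V) (hy : y ∈ H.hull D) : ∃ z : CC Z, φ z = y := by rwa [← hrange] at hy
  choose pt hpt using hex
  have hmem (z : CC Z) : φ z ∈ H.hull D := hrange ▸ mem_range_self z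
  obtain ⟨ρ, ψ, hψ⟩ := T.exists_action (A := fun _ : PUnit => A.obj) (fun _ => φ) hφ
    (fun y z h => hinj (h ⟨⟩))
    (fun m z => pt _ (H.mapsTo_hull (A := A.obj.V) (A.obj.ρ m) (hD m) (hmem z)))
    (fun i m z => hpt _ _)
  let W : Action C M := ⟨Z, ρ⟩
  obtain ⟨ψ, rfl⟩ : ∃ ψ' : W ⟶ A.obj, ψ'.hom = φ := ⟨ψ ⟨⟩, hψ ⟨⟩⟩
  obtain ⟨g, hg⟩ := T.lift hφ (Y := X) (fun x => pt (f x) (H.subset_hull D (hfD x)))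
    fun _ => ⟨f, fun x => (hpt _ _).symm⟩
  have hgf : g ≫ ψ.hom = f := ConcreteCategory.hom_ext _ _ fun x => by
    rw [comp_apply, hg]; exact hpt _ _
  refine ⟨⟨W, hF (fun _ => ψ) hφ fun _ => A.property⟩, g, ObjectProperty.homMk ψ, ?_, hgf,
    fun A' h k hhk => ?_⟩
  · -- `D` is a quotient of `M × X`, so that its filters inject into those of `M × X`.
    obtain ⟨j, hj⟩ := H.exists_injective D
    have hs : Function.Injective (fun d : D => (d.2.choose : M × CC X)) := fun d d' hdd => by
      ext
      rw [← d.2.choose_spec, ← d'.2.choose_spec]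
      exact congrArg orb hdd
    exact ⟨fun z => (j ⟨ψ.hom z, hmem z⟩).map _, (Filter.map_injective hs).comp
      (hj.comp fun y z hyz => hinj (congrArg Subtype.val hyz))⟩
  · ext : 2
    refine H.hom_ext ψ.hom D hφ hrange _ _ ?_
    -- Equivariant morphisms that agree on the image of `X` agree on its orbits.
    rintro z ⟨⟨m, x⟩, hz⟩
    have hz' : z = act W m (g x) := hinj (by
      rw [hom_act, ← comp_apply g, hgf]
      exact hz.symm)
    have key (l : W ⟶ A'.obj) : l.hom (act W m (g x)) = act A'.obj m ((g ≫ l.hom) x) := by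
      rw [hom_act, comp_apply]
    rw [hz', key h.hom, key k.hom, hhk]

/-- The monadicity criterion for categories of constrained flows. -/
theorem isMonadic_forgetFlow {T : InitialSources C} (H : HullSystem T)
    {F : ObjectProperty (Action C M)} (hF : ClosedUnderInitialSources T F)
    (hF' : ClosedUnderSplitQuotients F) : IsMonadic (forgetFlow F) := by
  have : (forgetFlow F).IsRightAdjoint := by
    refine isRightAdjoint_of_generating _ (exists_flow_prod T hF) fun X => ?_
    obtain ⟨ι, B, hB⟩ := exists_small_flows T hF' (Filter (M × CC X))
    refine ⟨ι, B, fun A f => ?_⟩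
    obtain ⟨B', g, m, hj, hgm, hu⟩ := exists_generated_flow H hF X A f
    obtain ⟨i, ⟨e⟩⟩ := hB B' hj
    refine ⟨i, g ≫ e.hom.hom.hom, e.inv ≫ m, ?_, fun A' h k hhk => ?_⟩
    · have : e.hom.hom.hom ≫ (e.inv ≫ m).hom.hom = m.hom.hom :=
        congrArg (fun l => l.hom.hom) (e.hom_inv_id_assoc m)
      exact (Category.assoc _ _ _).trans ((congrArg (g ≫ ·) this).trans hgm)
    · rw [← cancel_epi e.hom]
      exact hu A' _ _ ((Category.assoc _ _ _).symm.trans (hhk.trans (Category.assoc _ _ _)))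
  exact isMonadic_of_isRightAdjoint hF'

end Concrete

/-! ### Full subcategories of topological spaces -/

theorem eq_of_eq_on_preimage_of_range_eq_closure {Z A A' : Type*} [TopologicalSpace Z]
    [TopologicalSpace A] [TopologicalSpace A'] [T2Space A'] {ψ : Z → A} (hψ : IsInducing ψ)
    {D : Set A} (hD : range ψ = closure D) {h k : Z → A'} (hh : Continuous h) (hk : Continuous k)
    (hhk : ∀ z, ψ z ∈ D → h z = k z) : h = k := by
  refine Continuous.ext_on (s := ψ ⁻¹' D) (fun z => ?_) hh hk hhk
  rw [hψ.closure_eq_preimage_closure_image, image_preimage_eq_inter_range, hD,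
    inter_eq_left.2 subset_closure, mem_preimage, ← hD]
  exact mem_range_self z

/-- In a Hausdorff space a point of a closure is determined by the trace of its neighbourhood
filter. -/
theorem exists_injective_closure_filter {A : Type*} [TopologicalSpace A] [T2Space A] (D : Set A) :
    ∃ j : closure D → Filter D, Function.Injective j := by
  refine ⟨fun x => Filter.comap (↑) (𝓝 (x : A)), fun x y hxy => Subtype.ext ?_⟩
  have := mem_closure_iff_comap_neBot.1 x.2
  refine tendsto_nhds_unique (f := ((↑) : D → A)) Filter.tendsto_comap ?_
  exact (Filter.tendsto_comap (x := 𝓝 (y : A))).mono_left (le_of_eq hxy)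

/-- An operation refining all topologies, functorially: the identity, or the passage
to the compactly generated topology. -/
structure TopRefinement where
  /-- The refined topology. -/
  refine : ∀ {X : Type u}, TopologicalSpace X → TopologicalSpace X
  le : ∀ {X : Type u} (t : TopologicalSpace X), refine t ≤ t
  continuous_map : ∀ {X Y : Type u} {t : TopologicalSpace X} {t' : TopologicalSpace Y} {f : X → Y},
    Continuous[t, t'] f → Continuous[refine t, refine t'] f

namespace TopRefinement

/-- No refinement. -/
protected def id : TopRefinement.{u} where
  refine t := t
  le _ := le_rfl
  continuous_map h := h

/-- The compactly generated topology of `𝐤 X`, seen as a topology on the set `X` itself. -/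
protected noncomputable def k : TopRefinement.{u} where
  refine {X} _ := TopologicalSpace.induced (CompactCoherentification.mk X) inferInstance
  le {X} t := by
    rw [← continuous_id_iff_le]
    exact @Continuous.comp _ _ _ (_) _ _ _ _ CompactCoherentification.continuous_mk_symm
      continuous_induced_dom
  continuous_map {X Y t t' f} hf := by
    rw [continuous_induced_rng]
    exact @Continuous.comp X (𝐤 X) (𝐤 Y) (_) _ _ _ (CompactCoherentification.map f)
      (CompactCoherentification.continuous_map_of_continuous hf) continuous_induced_dom

theorem k_refine_eq {X : Type u} [t : TopologicalSpace X] [CompactlyCoherentSpace X] :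
    TopRefinement.k.refine t = t := by
  refine le_antisymm (TopRefinement.k.le t) ?_
  rw [← continuous_id_iff_le]
  exact continuous_induced_rng.2 CompactCoherentification.continuous_mk

theorem continuous_mk_k {X : Type u} (t : TopologicalSpace X) :
    Continuous[TopRefinement.k.refine t, CompactCoherentification.instTopologicalSpace]
      (CompactCoherentification.mk X) :=
  continuous_induced_dom

theorem compactlyCoherentSpace_k {X : Type u} (t : TopologicalSpace X) :
    @CompactlyCoherentSpace X (TopRefinement.k.refine t) := by
  refine @CompactlyCoherentSpace.of_isOpen_forall_compactSpace X (_) fun s hs => ?_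
  have h : IsOpen ((CompactCoherentification.mk X).symm ⁻¹' s) := by
    rw [CompactlyCoherentSpace.isOpen_iff_forall_compactSpace]
    exact fun K _ _ f hf =>
      hs K ((CompactCoherentification.mk X).symm ∘ f) (continuous_induced_rng.2 hf)
  exact @IsOpen.preimage _ _ (_) _ _ (continuous_mk_k t) _ h

/-- Continuity of maps into a refined initial topology, for spaces that the refinement fixes. -/
theorem continuous_rng (κ : TopRefinement.{u}) {ι : Type u} {Y Z : Type u} {A : ι → Type u}
    {tY : TopologicalSpace Y} {tZ : TopologicalSpace Z} {tA : ∀ i, TopologicalSpace (A i)}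
    {φ : ∀ i, Z → A i} (hZ : tZ = κ.refine (⨅ i, (tA i).induced (φ i)))
    (hY : κ.refine tY = tY) {g : Y → Z} (hg : ∀ i, Continuous (φ i ∘ g)) : Continuous g := by
  have h := κ.continuous_map (t := tY) (t' := ⨅ i, (tA i).induced (φ i)) (f := g)
    (continuous_iInf_rng.2 fun i => continuous_induced_rng.2 (hg i))
  rwa [hY, ← hZ] at h

end TopRefinement

/-- Up to isomorphism there is only a set of spaces on subsets of a fixed set. -/
theorem exists_small_top (P : ObjectProperty TopCat.{u}) (K : Type u) :
    ∃ (ι : Type u) (B : ι → P.FullSubcategory), ∀ A : P.FullSubcategory,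
      (∃ j : A.obj → K, Function.Injective j) → ∃ i, Nonempty (A ≅ B i) := by
  let I := {p : Σ S : Set K, TopologicalSpace S //
    ∃ A : P.FullSubcategory, Nonempty (A.obj ≅ @TopCat.of p.1 p.2)}
  refine ⟨I, fun p => p.2.choose, fun A ⟨j, hj⟩ => ?_⟩
  let e := Equiv.ofInjective j hj
  let t : TopologicalSpace (range j) := TopologicalSpace.induced e.symm inferInstance
  let h : range j ≃ₜ A.obj := e.symm.toHomeomorphOfIsInducing ⟨rfl⟩
  let p : I := ⟨⟨range j, t⟩, A, ⟨(TopCat.isoOfHomeo h).symm⟩⟩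
  exact ⟨p, ⟨P.isoMk ((TopCat.isoOfHomeo h).symm ≪≫ p.2.choose_spec.some.symm)⟩⟩

section Top

variable (κ : TopRefinement.{u}) (P : ObjectProperty TopCat.{u})

/-- A continuous map as a morphism in a full subcategory of topological spaces. -/
def topHom {P : ObjectProperty TopCat.{u}} {Z A : P.FullSubcategory} (f : Z.obj → A.obj)
    (hf : Continuous f) : Z ⟶ A :=
  ObjectProperty.homMk (TopCat.ofHom ⟨f, hf⟩)

/-- Initial sources for a full subcategory of topological spaces whose objects are fixed by a
refinement and which is closed under refined products. -/
def topInitialSources (hfix : ∀ X, P X → κ.refine X.str = X.str)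
    (hprod : ∀ {ι : Type u} (A : ι → TopCat.{u}), (∀ i, P (A i)) →
      P (@TopCat.of (∀ i, A i) (κ.refine Pi.topologicalSpace))) :
    InitialSources P.FullSubcategory where
  IsInitial {_ Z A} φ :=
    Z.obj.str = κ.refine (⨅ i, (A i).obj.str.induced (φ i))
  lift {ι Z A φ} hφ Y h hh := by
    refine ⟨topHom h ?_, fun y => rfl⟩
    refine κ.continuous_rng hφ (hfix _ Y.property) fun i => ?_
    obtain ⟨k, hk⟩ := hh i
    exact (continuous_congr hk).1 k.hom.hom.continuous
  prod {ι} A := by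
    let Z : P.FullSubcategory := ⟨@TopCat.of (∀ i, (A i).obj) (κ.refine Pi.topologicalSpace),
      hprod (fun i => (A i).obj) fun i => (A i).property⟩
    have hZ (i) : Continuous[κ.refine Pi.topologicalSpace, _] fun x : (∀ i, (A i).obj) => x i :=
      continuous_le_dom (κ.le _) (continuous_apply i)
    exact ⟨Z, fun i => topHom _ (hZ i), rfl,
      Function.bijective_id⟩
  small := exists_small_top P

variable {κ P} {hfix : ∀ X, P X → κ.refine X.str = X.str}
  {hprod : ∀ {ι : Type u} (A : ι → TopCat.{u}), (∀ i, P (A i)) →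
      P (@TopCat.of (∀ i, A i) (κ.refine Pi.topologicalSpace))}

theorem exists_top_sub {A : P.FullSubcategory} (D : Set A.obj)
    (hD : P (@TopCat.of D (κ.refine instTopologicalSpaceSubtype))) :
    ∃ (Z : P.FullSubcategory) (ψ : Z ⟶ A),
      (topInitialSources κ P hfix hprod).IsInitial (fun _ : PUnit.{u + 1} => ψ) ∧
        Function.Injective ψ ∧ range ψ = D := by
  have hc : Continuous[κ.refine instTopologicalSpaceSubtype, _] ((↑) : D → A.obj) :=
    continuous_le_dom (κ.le _) continuous_subtype_val
  refine ⟨⟨_, hD⟩, topHom _ hc, ?_,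
    Subtype.val_injective, Subtype.range_val⟩
  change κ.refine _ = κ.refine _
  rw [iInf_const]
  rfl

/-- If all subspaces are available, a subset is its own hull. -/
def topHullSystem (hsub : ∀ (A : TopCat.{u}) (D : Set A), P A →
    P (@TopCat.of D (κ.refine instTopologicalSpaceSubtype))) :
    HullSystem (topInitialSources κ P hfix hprod) where
  hull D := D
  subset_hull _ := subset_rfl
  mapsTo_hull _ _ _ h := h
  exists_injective _ := ⟨pure, Filter.pure_injective⟩
  sub {A} D := exists_top_sub D (hsub A.obj D A.property)
  hom_ext _ _ _ hD _ _ hhk := ConcreteCategory.hom_ext _ _ fun z =>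
    hhk z (hD ▸ mem_range_self z)

/-- In categories of Hausdorff spaces with all closed subspaces, the closure is a hull. -/
def topClosureHullSystem {hfix : ∀ X, P X → TopRefinement.id.refine X.str = X.str}
    {hprod : ∀ {ι : Type u} (A : ι → TopCat.{u}), (∀ i, P (A i)) →
      P (@TopCat.of (∀ i, A i) (TopRefinement.id.refine Pi.topologicalSpace))}
    (hT2 : ∀ A, P A → T2Space A)
    (hsub : ∀ (A : TopCat.{u}) (D : Set A), IsClosed D → P A → P (TopCat.of D)) :
    HullSystem (topInitialSources TopRefinement.id P hfix hprod) where
  hull {A} D := closure (X := A.obj) D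
  subset_hull _ := subset_closure
  mapsTo_hull f _ _ h := h.closure f.hom.hom.continuous
  exists_injective {A} D :=
    have := hT2 _ A.property
    exists_injective_closure_filter (A := A.obj) D
  sub {A} D := exists_top_sub _ (hsub A.obj _ isClosed_closure A.property)
  hom_ext {Z A A'} ψ D hψ hD h k hhk := by
    have := hT2 _ A'.property
    have hψ' : IsInducing ψ.hom := ⟨hψ.trans (iInf_const (ι := PUnit))⟩
    exact ConcreteCategory.hom_ext _ _ <| congrFun <|
      eq_of_eq_on_preimage_of_range_eq_closure hψ' hD h.hom.hom.continuous k.hom.hom.continuous hhk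

end Top

/-! ### Flows on topological and on compactly generated spaces -/

theorem functionallyHausdorff_of_injective {X Y : Type u} [TopologicalSpace X]
    [TopologicalSpace Y] {f : X → Y} (hf : Continuous f) (hinj : Function.Injective f)
    (hY : FunctionallyHausdorff Y) : FunctionallyHausdorff X := fun x y hxy => by
  obtain ⟨g, hg, hne⟩ := hY _ _ (hinj.ne hxy)
  exact ⟨g ∘ f, hg.comp hf, hne⟩

theorem functionallyHausdorff_pi {ι : Type u} {A : ι → Type u} [∀ i, TopologicalSpace (A i)]
    (hA : ∀ i, FunctionallyHausdorff (A i)) : FunctionallyHausdorff (∀ i, A i) := fun x y hxy => by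
  obtain ⟨i, hi⟩ := Function.ne_iff.1 hxy
  obtain ⟨g, hg, hne⟩ := hA i _ _ hi
  exact ⟨fun z => g (z i), hg.comp (continuous_apply i), hne⟩

theorem TopKind.prop_pi (k : TopKind) {ι : Type u} (A : ι → TopCat.{u})
    (hA : ∀ i, k.prop (A i)) : k.prop (TopCat.of (∀ i, A i)) := by
  cases k with
  | all => trivial
  | t0 => have inst (i) : T0Space (A i) := hA i; exact inferInstanceAs (T0Space (∀ i, A i))
  | t1 => have inst (i) : T1Space (A i) := hA i; exact inferInstanceAs (T1Space (∀ i, A i))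
  | t2 => have inst (i) : T2Space (A i) := hA i; exact inferInstanceAs (T2Space (∀ i, A i))
  | t2f => exact functionallyHausdorff_pi hA
  | t35 => have inst (i) : T35Space (A i) := hA i; exact inferInstanceAs (T35Space (∀ i, A i))
  | compactT2 =>
    have inst₁ (i) : CompactSpace (A i) := (hA i).1
    have inst (i) : T2Space (A i) := (hA i).2
    exact ⟨inferInstanceAs (CompactSpace (∀ i, A i)), inferInstanceAs (T2Space (∀ i, A i))⟩

theorem TopKind.prop_sub (k : TopKind) (hk : k ≠ .compactT2) (A : TopCat.{u}) (D : Set A)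
    (hA : k.prop A) : k.prop (TopCat.of D) := by
  cases k with
  | all => trivial
  | t0 => have : T0Space A := hA; exact inferInstanceAs (T0Space D)
  | t1 => have : T1Space A := hA; exact inferInstanceAs (T1Space D)
  | t2 => have : T2Space A := hA; exact inferInstanceAs (T2Space D)
  | t2f =>
    exact functionallyHausdorff_of_injective continuous_subtype_val Subtype.val_injective hA
  | t35 => have : T35Space A := hA; exact inferInstanceAs (T35Space D)
  | compactT2 => exact absurd rfl hk

/-- Initial sources in the categories of topological spaces. -/
def TopKind.initialSources (k : TopKind) : InitialSources k.prop.FullSubcategory :=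
  topInitialSources TopRefinement.id.{u} k.prop (fun _ _ => rfl) k.prop_pi

/-- The hull of a set is its closure for compact Hausdorff spaces, and the set itself in the other
categories of topological spaces. -/
theorem TopKind.nonempty_hullSystem (k : TopKind) :
    Nonempty (HullSystem k.initialSources.{u}) := by
  by_cases hk : k = .compactT2
  · subst hk
    refine ⟨topClosureHullSystem (fun A hA => hA.2) fun A D hD hA => ?_⟩
    have : CompactSpace A := hA.1
    have : T2Space A := hA.2
    exact ⟨isCompact_iff_compactSpace.1 hD.isCompact, inferInstanceAs (T2Space D)⟩
  · exact ⟨topHullSystem (k.prop_sub hk)⟩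

theorem KTopKind.prop_iff (k : KTopKind) (A : TopCat.{u}) :
    k.prop A ↔ CompactlyCoherentSpace A ∧ (k = .t2 → T2Space A) := by
  cases k <;> simp [KTopKind.prop]

theorem t2Space_of_le {X : Type u} {s t : TopologicalSpace X} (h : s ≤ t) (ht : @T2Space X t) :
    @T2Space X s :=
  @T2Space.of_injective_continuous X X s t ht id Function.injective_id (continuous_id_iff_le.2 h)

theorem KTopKind.prop_refine (k : KTopKind) {X : Type u} (t : TopologicalSpace X)
    (h : k = .t2 → T2Space X) : k.prop (@TopCat.of X (TopRefinement.k.refine t)) :=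
  (k.prop_iff _).2 ⟨TopRefinement.compactlyCoherentSpace_k t,
    fun hk => t2Space_of_le (TopRefinement.k.le t) (h hk)⟩

theorem KTopKind.prop_pi (k : KTopKind) {ι : Type u} (A : ι → TopCat.{u})
    (hA : ∀ i, k.prop (A i)) :
    k.prop (@TopCat.of (∀ i, A i) (TopRefinement.k.refine Pi.topologicalSpace)) :=
  k.prop_refine _ fun hk => by
    have inst (i) : T2Space (A i) := ((k.prop_iff _).1 (hA i)).2 hk
    infer_instance

/-- Initial sources in the categories of compactly generated spaces. -/
noncomputable def KTopKind.initialSources (k : KTopKind) : InitialSources k.prop.FullSubcategory :=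
  topInitialSources TopRefinement.k.{u} k.prop
    (fun X hX => by
      have := ((k.prop_iff X).1 hX).1
      exact TopRefinement.k_refine_eq)
    k.prop_pi

/-- In categories of compactly generated spaces, every subset is its own hull. -/
noncomputable def KTopKind.hullSystem (k : KTopKind) : HullSystem k.initialSources.{u} :=
  topHullSystem (hprod := k.prop_pi) fun A D hA => k.prop_refine _ fun hk => by
    have : T2Space A := ((k.prop_iff _).1 hA).2 hk
    infer_instance

section

variable {P : ObjectProperty TopCat.{u}} {M : Type u} [Monoid M]

theorem hom_topAct {A B : Action P.FullSubcategory M} (f : A ⟶ B) (m : M) (x : A.V.obj) :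
    f.hom (topAct A m x) = topAct B m (f.hom x) :=
  ConcreteCategory.congr_hom (f.comm m) x

theorem topAct_eq_of_section {A B : Action P.FullSubcategory M} (q : A ⟶ B) (s : B.V ⟶ A.V)
    (hs : s ≫ q.hom = 𝟙 B.V) (m : M) (x : B.V.obj) :
    topAct B m x = q.hom (topAct A m (s x)) := by
  rw [hom_topAct]
  congr 1
  exact (ConcreteCategory.congr_hom hs x).symm

theorem continuous_topAct (A : Action P.FullSubcategory M) (m : M) : Continuous (topAct A m) :=
  (ConcreteCategory.hom (C := TopCat) (X := A.V.obj) (Y := A.V.obj)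
    (show A.V ⟶ A.V from A.ρ m).hom).continuous

end

section

variable {M : Type u} [Monoid M] [TopologicalSpace M] (𝒮 𝒥 : Set (Set M))

theorem closedUnderSplitQuotients_topConstraint (P : ObjectProperty TopCat.{u}) :
    ClosedUnderSplitQuotients (TopConstraint P M 𝒮 𝒥) := by
  intro A B q s hs hA
  have hq : Continuous q.hom := q.hom.hom.hom.continuous
  have hs' : Continuous s := s.hom.hom.continuous
  refine ⟨fun S hS => ⟨fun m => continuous_topAct B m, fun x => ?_⟩, fun J hJ => ?_⟩
  · simp only [topAct_eq_of_section q s hs]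
    exact hq.comp ((hA.1 S hS).2 _)
  · simp only [topAct_eq_of_section q s hs]
    exact hq.comp ((hA.2 J hJ).comp (continuous_id.prodMap hs'))

theorem closedUnderInitialSources_topConstraint (k : TopKind) :
    ClosedUnderInitialSources k.initialSources (TopConstraint k.prop M 𝒮 𝒥) := by
  intro ι Z A φ hφ hA
  have hc (i) : Continuous (φ i).hom := (φ i).hom.hom.hom.continuous
  refine ⟨fun S hS => ⟨fun m => continuous_topAct Z m, fun x => ?_⟩, fun J hJ => ?_⟩
  · refine TopRefinement.id.continuous_rng hφ rfl fun i => ?_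
    exact (continuous_congr fun m : S => hom_topAct (φ i) m x).2 (((hA i).1 S hS).2 _)
  · refine TopRefinement.id.continuous_rng hφ rfl fun i => ?_
    exact (continuous_congr fun p : J × Z.V.obj => hom_topAct (φ i) p.1 p.2).2
      (((hA i).2 J hJ).comp (continuous_id.prodMap (hc i)))

theorem closedUnderSplitQuotients_kTopConstraint (P : ObjectProperty TopCat.{u}) :
    ClosedUnderSplitQuotients (KTopConstraint P M 𝒮 𝒥) := by
  intro A B q s hs hA
  have hq : Continuous q.hom := q.hom.hom.hom.continuous
  have hs' : Continuous s := s.hom.hom.continuous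
  refine ⟨fun S hS => ⟨fun m => continuous_topAct B m, fun x => ?_⟩, fun J hJ => ?_⟩
  · simp only [topAct_eq_of_section q s hs]
    exact hq.comp ((hA.1 S hS).2 _)
  · simp only [topAct_eq_of_section q s hs]
    exact hq.comp ((hA.2 J hJ).comp
      (CompactCoherentification.continuous_map_of_continuous (continuous_id.prodMap hs')))

theorem closedUnderInitialSources_kTopConstraint (k : KTopKind) :
    ClosedUnderInitialSources k.initialSources (KTopConstraint k.prop M 𝒮 𝒥) := by
  intro ι Z A φ hφ hA
  have hc (i) : Continuous (φ i).hom := (φ i).hom.hom.hom.continuous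
  refine ⟨fun S hS => ⟨fun m => continuous_topAct Z m, fun x => ?_⟩, fun J hJ => ?_⟩
  · refine TopRefinement.k.continuous_rng hφ TopRefinement.k_refine_eq fun i => ?_
    exact (continuous_congr fun m => hom_topAct (φ i) _ x).2 (((hA i).1 S hS).2 _)
  · refine TopRefinement.k.continuous_rng hφ TopRefinement.k_refine_eq fun i => ?_
    exact (continuous_congr fun p => hom_topAct (φ i) _ _).2
      (((hA i).2 J hJ).comp
        (CompactCoherentification.continuous_map_of_continuous (continuous_id.prodMap (hc i))))

end

/-! ### Flows on uniform spaces -/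

/-- Up to isomorphism there is only a set of uniform spaces on subsets of a fixed set. -/
theorem exists_small_unif (P : ObjectProperty UniformSpaceCat.{u}) (K : Type u) :
    ∃ (ι : Type u) (B : ι → P.FullSubcategory), ∀ A : P.FullSubcategory,
      (∃ j : A.obj → K, Function.Injective j) → ∃ i, Nonempty (A ≅ B i) := by
  let I := {p : Σ S : Set K, UniformSpace S //
    ∃ A : P.FullSubcategory, Nonempty (A.obj ≅ @UniformSpaceCat.of p.1 p.2)}
  refine ⟨I, fun p => p.2.choose, fun A ⟨j, hj⟩ => ?_⟩
  let e := Equiv.ofInjective j hj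
  let t : UniformSpace (range j) := UniformSpace.comap e.symm inferInstance
  have he : UniformContinuous e := by
    refine uniformContinuous_comap' ?_
    rw [e.symm_comp_self]
    exact uniformContinuous_id
  let h : A.obj ≅ UniformSpaceCat.of (range j) :=
    { hom := UniformSpaceCat.ofHom ⟨e, he⟩
      inv := UniformSpaceCat.ofHom ⟨e.symm, uniformContinuous_comap⟩
      hom_inv_id := UniformSpaceCat.hom_ext (funext e.symm_apply_apply)
      inv_hom_id := UniformSpaceCat.hom_ext (funext e.apply_symm_apply) }
  let p : I := ⟨⟨range j, t⟩, A, ⟨h⟩⟩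
  exact ⟨p, ⟨P.isoMk (h ≪≫ p.2.choose_spec.some.symm)⟩⟩

section Unif

variable (P : ObjectProperty UniformSpaceCat.{u})

/-- A uniformly continuous map as a morphism in a full subcategory of uniform spaces. -/
def unifHom {P : ObjectProperty UniformSpaceCat.{u}} {Z A : P.FullSubcategory} (f : Z.obj → A.obj)
    (hf : UniformContinuous f) : Z ⟶ A :=
  ObjectProperty.homMk (UniformSpaceCat.ofHom ⟨f, hf⟩)

theorem uniformContinuous_hom {P : ObjectProperty UniformSpaceCat.{u}} {Z A : P.FullSubcategory}
    (f : Z ⟶ A) : UniformContinuous (f : Z.obj → A.obj) :=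
  f.hom.hom.2

theorem uniformContinuous_rng_iInf_comap {ι Y Z : Type*} {A : ι → Type*} {tY : UniformSpace Y}
    {tZ : UniformSpace Z} {tA : ∀ i, UniformSpace (A i)} {φ : ∀ i, Z → A i}
    (hZ : tZ = ⨅ i, (tA i).comap (φ i)) {g : Y → Z} (hg : ∀ i, UniformContinuous (φ i ∘ g)) :
    UniformContinuous g := by
  subst hZ
  exact uniformContinuous_iInf_rng.2 fun i => uniformContinuous_comap' (hg i)

/-- Initial sources for a full subcategory of uniform spaces closed under products. -/
def unifInitialSources (hprod : ∀ {ι : Type u} (A : ι → UniformSpaceCat.{u}), (∀ i, P (A i)) →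
      P (UniformSpaceCat.of (∀ i, A i))) :
    InitialSources P.FullSubcategory where
  IsInitial {_ Z A} φ := Z.obj.str = ⨅ i, (A i).obj.str.comap (φ i)
  lift {ι Z A φ} hφ Y h hh := by
    refine ⟨unifHom h (uniformContinuous_rng_iInf_comap hφ fun i => ?_), fun y => rfl⟩
    obtain ⟨k, hk⟩ := hh i
    have h' : ⇑k = φ i ∘ h := funext hk
    exact h' ▸ uniformContinuous_hom k
  prod {ι} A := by
    let Z : P.FullSubcategory := ⟨UniformSpaceCat.of (∀ i, (A i).obj),
      hprod (fun i => (A i).obj) fun i => (A i).property⟩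
    exact ⟨Z, fun i => unifHom _ (Pi.uniformContinuous_proj _ i), Pi.uniformSpace_eq _,
      Function.bijective_id⟩
  small := exists_small_unif P

variable {P} {hprod : ∀ {ι : Type u} (A : ι → UniformSpaceCat.{u}), (∀ i, P (A i)) →
      P (UniformSpaceCat.of (∀ i, A i))}

theorem exists_unif_sub {A : P.FullSubcategory} (D : Set A.obj) (hD : P (UniformSpaceCat.of D)) :
    ∃ (Z : P.FullSubcategory) (ψ : Z ⟶ A),
      (unifInitialSources P hprod).IsInitial (fun _ : PUnit.{u + 1} => ψ) ∧
        Function.Injective ψ ∧ range ψ = D := by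
  refine ⟨⟨_, hD⟩, unifHom _ uniformContinuous_subtype_val, ?_, Subtype.val_injective,
    Subtype.range_val⟩
  exact (iInf_const (ι := PUnit)).symm

/-- If all subspaces are available, a subset is its own hull. -/
def unifHullSystem (hsub : ∀ (A : UniformSpaceCat.{u}) (D : Set A), P A →
    P (UniformSpaceCat.of D)) : HullSystem (unifInitialSources P hprod) where
  hull D := D
  subset_hull _ := subset_rfl
  mapsTo_hull _ _ _ h := h
  exists_injective _ := ⟨pure, Filter.pure_injective⟩
  sub {A} D := exists_unif_sub D (hsub A.obj D A.property)
  hom_ext _ _ _ hD _ _ hhk := ConcreteCategory.hom_ext _ _ fun z =>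
    hhk z (hD ▸ mem_range_self z)

/-- In categories of Hausdorff uniform spaces with all closed subspaces, the closure is a hull. -/
def unifClosureHullSystem (hT2 : ∀ A, P A → T2Space A)
    (hsub : ∀ (A : UniformSpaceCat.{u}) (D : Set A), IsClosed D → P A →
      P (UniformSpaceCat.of D)) :
    HullSystem (unifInitialSources P hprod) where
  hull {A} D := closure (X := A.obj) D
  subset_hull _ := subset_closure
  mapsTo_hull f _ _ h := h.closure (uniformContinuous_hom f).continuous
  exists_injective {A} D :=
    have := hT2 _ A.property
    exists_injective_closure_filter (A := A.obj) D
  sub {A} D := exists_unif_sub _ (hsub A.obj _ isClosed_closure A.property)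
  hom_ext {Z A A'} ψ D hψ hD h k hhk := by
    have := hT2 _ A'.property
    have hψ' : IsUniformInducing (ψ : Z.obj → A.obj) :=
      isUniformInducing_iff_uniformSpace.2 (hψ.trans (iInf_const (ι := PUnit))).symm
    exact ConcreteCategory.hom_ext _ _ <| congrFun <|
      eq_of_eq_on_preimage_of_range_eq_closure hψ'.isInducing hD
        (uniformContinuous_hom h).continuous (uniformContinuous_hom k).continuous hhk

end Unif

theorem UnifKind.prop_pi (k : UnifKind) {ι : Type u} (A : ι → UniformSpaceCat.{u})
    (hA : ∀ i, k.prop (A i)) : k.prop (UniformSpaceCat.of (∀ i, A i)) := by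
  cases k with
  | all => trivial
  | t2 => have inst (i) : T2Space (A i) := hA i; exact inferInstanceAs (T2Space (∀ i, A i))
  | completeT2 =>
    have inst₁ (i) : CompleteSpace (A i) := (hA i).1
    have inst (i) : T2Space (A i) := (hA i).2
    exact ⟨inferInstanceAs (CompleteSpace (∀ i, A i)), inferInstanceAs (T2Space (∀ i, A i))⟩

/-- Initial sources in the categories of uniform spaces. -/
def UnifKind.initialSources (k : UnifKind) : InitialSources k.prop.FullSubcategory :=
  unifInitialSources.{u} k.prop k.prop_pi

/-- The hull of a set is its closure for complete Hausdorff uniform spaces, and the set itself in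
the other two categories of uniform spaces. -/
theorem UnifKind.nonempty_hullSystem (k : UnifKind) :
    Nonempty (HullSystem k.initialSources.{u}) := by
  cases k with
  | all => exact ⟨unifHullSystem fun _ _ _ => trivial⟩
  | t2 =>
    refine ⟨unifHullSystem fun A D hA => ?_⟩
    have : T2Space A := hA
    exact inferInstanceAs (T2Space D)
  | completeT2 =>
    refine ⟨unifClosureHullSystem (fun A hA => hA.2) fun A D hD hA => ?_⟩
    have : CompleteSpace A := hA.1
    have : T2Space A := hA.2
    exact ⟨hD.completeSpace_coe, inferInstanceAs (T2Space D)⟩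

section

variable {P : ObjectProperty UniformSpaceCat.{u}} {M : Type u} [Monoid M]

theorem hom_unifAct {A B : Action P.FullSubcategory M} (f : A ⟶ B) (m : M) (x : A.V.obj) :
    f.hom (unifAct A m x) = unifAct B m (f.hom x) :=
  ConcreteCategory.congr_hom (f.comm m) x

theorem unifAct_eq_of_section {A B : Action P.FullSubcategory M} (q : A ⟶ B) (s : B.V ⟶ A.V)
    (hs : s ≫ q.hom = 𝟙 B.V) (m : M) (x : B.V.obj) :
    unifAct B m x = q.hom (unifAct A m (s x)) := by
  rw [hom_unifAct]
  congr 1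
  exact (ConcreteCategory.congr_hom hs x).symm

theorem uniformContinuous_unifAct (A : Action P.FullSubcategory M) (m : M) :
    UniformContinuous (unifAct A m) :=
  uniformContinuous_hom (show A.V ⟶ A.V from A.ρ m)

end

section

variable {M : Type u} [Monoid M] [UniformSpace M] (𝒮 𝒥 : Set (Set M))

theorem closedUnderSplitQuotients_unifConstraint (P : ObjectProperty UniformSpaceCat.{u}) :
    ClosedUnderSplitQuotients (UnifConstraint P M 𝒮 𝒥) := by
  intro A B q s hs hA
  have hq := uniformContinuous_hom q.hom
  have hs' := uniformContinuous_hom s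
  refine ⟨fun S hS => ⟨fun m => uniformContinuous_unifAct B m, fun x => ?_⟩, fun J hJ => ?_⟩
  · simp only [unifAct_eq_of_section q s hs]
    exact hq.comp ((hA.1 S hS).2 _)
  · simp only [unifAct_eq_of_section q s hs]
    exact hq.comp ((hA.2 J hJ).comp (uniformContinuous_id.prodMap hs'))

theorem closedUnderInitialSources_unifConstraint (k : UnifKind) :
    ClosedUnderInitialSources k.initialSources (UnifConstraint k.prop M 𝒮 𝒥) := by
  intro ι Z A φ hφ hA
  have hc (i) := uniformContinuous_hom (φ i).hom
  refine ⟨fun S hS => ⟨fun m => uniformContinuous_unifAct Z m, fun x => ?_⟩, fun J hJ => ?_⟩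
  · refine uniformContinuous_rng_iInf_comap hφ fun i => ?_
    have h := ((hA i).1 S hS).2 ((φ i).hom x)
    simp only [← hom_unifAct] at h
    exact h
  · refine uniformContinuous_rng_iInf_comap hφ fun i => ?_
    have h := ((hA i).2 J hJ).comp (uniformContinuous_id.prodMap (hc i))
    simp only [Function.comp_def, Prod.map, id, ← hom_unifAct] at h
    exact h

end

section

open Filter

variable {P : ObjectProperty UniformSpaceCat.{u}} {G : Type u} [Group G] [TopologicalSpace G]

/-- A flow is bounded if and only if `s ▷ y` converges to `y`, uniformly in `y`, as `s` tends
to `1`. -/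
theorem boundedFlow_iff (A : Action P.FullSubcategory G) :
    BoundedFlow P G A ↔
      Tendsto (fun p : G × A.V.obj => (unifAct A p.1 p.2, p.2)) (𝓝 1 ×ˢ ⊤) (𝓤 A.V.obj) := by
  refine forall₂_congr fun V _ => ?_
  rw [mem_map, ← principal_univ, mem_prod_principal]
  constructor
  · rintro ⟨N, hN, h⟩
    exact mem_of_superset hN fun s hs y _ => h s hs y
  · exact fun h => ⟨_, h, fun s hs y => hs y trivial⟩

/-- A flow is quasi-bounded if and only if `s ▷ x` and `s ▷ y` become close as `s` tends to `1`
and `(x, y)` tends to the diagonal. -/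
theorem quasiBoundedFlow_iff (A : Action P.FullSubcategory G) :
    QuasiBoundedFlow P G A ↔
      Tendsto (fun p : G × A.V.obj × A.V.obj => (unifAct A p.1 p.2.1, unifAct A p.1 p.2.2))
        (𝓝 1 ×ˢ 𝓤 A.V.obj) (𝓤 A.V.obj) := by
  refine forall₂_congr fun W _ => ?_
  rw [mem_map, mem_prod_iff]
  refine exists_congr fun N => and_congr_right fun _ => exists_congr fun V =>
    and_congr_right fun _ => ?_
  exact ⟨fun h p hp => h p.1 hp.1 p.2.1 p.2.2 hp.2, fun h s hs x y hxy =>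
    h (mk_mem_prod (b := (x, y)) hs hxy)⟩

theorem closedUnderSplitQuotients_boundedFlow :
    ClosedUnderSplitQuotients (BoundedFlow P G) := by
  intro A B q s hs hA
  rw [boundedFlow_iff] at hA ⊢
  have hq : Tendsto _ (𝓤 A.V.obj) (𝓤 B.V.obj) := uniformContinuous_hom q.hom
  have h := hq.comp (hA.comp (tendsto_id.prodMap (tendsto_top : Tendsto s ⊤ ⊤)))
  refine h.congr fun p => Prod.ext (unifAct_eq_of_section q s hs p.1 p.2).symm ?_
  exact ConcreteCategory.congr_hom hs p.2

theorem closedUnderSplitQuotients_quasiBoundedFlow :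
    ClosedUnderSplitQuotients (QuasiBoundedFlow P G) := by
  intro A B q s hs hA
  rw [quasiBoundedFlow_iff] at hA ⊢
  have hq : Tendsto _ (𝓤 A.V.obj) (𝓤 B.V.obj) := uniformContinuous_hom q.hom
  have hs' : Tendsto _ (𝓤 B.V.obj) (𝓤 A.V.obj) := uniformContinuous_hom s
  refine (hq.comp (hA.comp (tendsto_id.prodMap hs'))).congr fun p => ?_
  exact Prod.ext (unifAct_eq_of_section q s hs p.1 p.2.1).symm
    (unifAct_eq_of_section q s hs p.1 p.2.2).symm

theorem tendsto_uniformity_iInf_comap {ι X Z : Type*} {A : ι → Type*}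
    {tZ : UniformSpace Z} {tA : ∀ i, UniformSpace (A i)} {φ : ∀ i, Z → A i}
    (hZ : tZ = ⨅ i, (tA i).comap (φ i)) {l : Filter X} {g : X → Z × Z}
    (hg : ∀ i, Tendsto (fun x => (φ i (g x).1, φ i (g x).2)) l (𝓤 (A i))) :
    Tendsto g l (𝓤 Z) := by
  subst hZ
  rw [iInf_uniformity, tendsto_iInf]
  intro i
  rw [uniformity_comap, tendsto_comap_iff]
  exact hg i

theorem closedUnderInitialSources_boundedFlow (k : UnifKind) :
    ClosedUnderInitialSources k.initialSources (BoundedFlow k.prop G) := by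
  intro ι Z A φ hφ hA
  rw [boundedFlow_iff]
  refine tendsto_uniformity_iInf_comap hφ fun i => ?_
  refine (((boundedFlow_iff (A i)).1 (hA i)).comp
    (tendsto_id.prodMap (tendsto_top : Tendsto (φ i).hom ⊤ ⊤))).congr fun p => ?_
  exact Prod.ext (hom_unifAct (φ i) p.1 p.2).symm rfl

theorem closedUnderInitialSources_quasiBoundedFlow (k : UnifKind) :
    ClosedUnderInitialSources k.initialSources (QuasiBoundedFlow k.prop G) := by
  intro ι Z A φ hφ hA
  rw [quasiBoundedFlow_iff]
  refine tendsto_uniformity_iInf_comap hφ fun i => ?_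
  have hc : Tendsto _ (𝓤 Z.V.obj) (𝓤 (A i).V.obj) := uniformContinuous_hom (φ i).hom
  refine (((quasiBoundedFlow_iff (A i)).1 (hA i)).comp (tendsto_id.prodMap hc)).congr fun p => ?_
  exact Prod.ext (hom_unifAct (φ i) p.1 p.2.1).symm (hom_unifAct (φ i) p.1 p.2.2).symm

end

end Flows

theorem theorem2p7 :
    (∀ (M : Type u) [Monoid M] [TopologicalSpace M] [ContinuousMul M] (𝒮 𝒥 : Set (Set M))
      (k : Flows.TopKind),
      Flows.IsMonadic (Flows.forgetFlow (Flows.TopConstraint k.prop M 𝒮 𝒥))) ∧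
    (∀ (M : Type u) [Monoid M] [UniformSpace M] (𝒮 𝒥 : Set (Set M)) (k : Flows.UnifKind),
      Flows.IsMonadic (Flows.forgetFlow (Flows.UnifConstraint k.prop M 𝒮 𝒥))) ∧
    (∀ (M : Type u) [Monoid M] [TopologicalSpace M] [CompactlyCoherentSpace M]
      (_ : Flows.KContinuousMul M) (𝒮 𝒥 : Set (Set M)) (k : Flows.KTopKind),
      Flows.IsMonadic (Flows.forgetFlow (Flows.KTopConstraint k.prop M 𝒮 𝒥))) ∧
    (∀ (G : Type u) [Group G] [TopologicalSpace G] [IsTopologicalGroup G] (k : Flows.UnifKind),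
      Flows.IsMonadic (Flows.forgetFlow (Flows.BoundedFlow k.prop G)) ∧
      Flows.IsMonadic (Flows.forgetFlow (Flows.QuasiBoundedFlow k.prop G))) := by
  refine ⟨fun M _ _ _ 𝒮 𝒥 k => ?_, fun M _ _ 𝒮 𝒥 k => ?_, fun M _ _ _ _ 𝒮 𝒥 k => ?_,
    fun G _ _ _ k => ?_⟩
  · obtain ⟨H⟩ := k.nonempty_hullSystem
    exact Flows.isMonadic_forgetFlow H (Flows.closedUnderInitialSources_topConstraint 𝒮 𝒥 k)
      (Flows.closedUnderSplitQuotients_topConstraint 𝒮 𝒥 _)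
  · obtain ⟨H⟩ := k.nonempty_hullSystem
    exact Flows.isMonadic_forgetFlow H (Flows.closedUnderInitialSources_unifConstraint 𝒮 𝒥 k)
      (Flows.closedUnderSplitQuotients_unifConstraint 𝒮 𝒥 _)
  · exact Flows.isMonadic_forgetFlow k.hullSystem
      (Flows.closedUnderInitialSources_kTopConstraint 𝒮 𝒥 k)
      (Flows.closedUnderSplitQuotients_kTopConstraint 𝒮 𝒥 _)
  · obtain ⟨H⟩ := k.nonempty_hullSystem
    exact ⟨Flows.isMonadic_forgetFlow H (Flows.closedUnderInitialSources_boundedFlow k)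
        Flows.closedUnderSplitQuotients_boundedFlow,
      Flows.isMonadic_forgetFlow H (Flows.closedUnderInitialSources_quasiBoundedFlow k)
        Flows.closedUnderSplitQuotients_quasiBoundedFlow⟩
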